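/- Let $K=\mathbb{Q}(i)$, $\zeta_{15}=e^{2\pi i/15}$, $\theta=\zeta_{15}+\zeta_{15}^{-1}=2\cos(2\pi/15)$, $L=K(\theta)$ with ring of integers $\mathcal{O}_L$, let $\sigma$ be the $K$-automorphism of $L$ with $\sigma(\zeta_{15}+\zeta_{15}^{-1})=\zeta_{15}^2+\zeta_{15}^{-2}$, and put $\gamma=i$, $\alpha=(1-3i)+i\theta^2$. For $x=(x_0,\dots,x_3)\in\mathcal{O}_L^4$ let $$\mathbf{X}(x)=\operatorname{diag}\bigl(\alpha,\sigma(\alpha),\sigma^2(\alpha),\sigma^3(\alpha)\bigr)\begin{pmatrix}x_0&x_1&x_2&x_3\\ \gamma\sigma(x_3)&\sigma(x_0)&\sigma(x_1)&\sigma(x_2)\\ \gamma\sigma^2(x_2)&\gamma\sigma^2(x_3)&\sigma^2(x_0)&\sigma^2(x_1)\\ \gamma\sigma^3(x_1)&\gamma\sigma^3(x_2)&\gamma\sigma^3(x_3)&\sigma^3(x_0)\end{pmatrix}$$ be the corresponding codeword of the $4\times4$ perfect space-time code. Let $\mathfrak{q}_1,\dots,\mathfrak{q}_N$ be nonzero,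 pairwise relatively prime ideals of $\mathcal{O}_L$, $\mathfrak{q}=\mathfrak{q}_1\cdots\mathfrak{q}_N$, and let $\mathcal{M}$ map each element of $\prod_k\mathcal{O}_L/\mathfrak{q}_k\cong\mathcal{O}_L/\mathfrak{q}$ to a representative in $\mathcal{O}_L$ of the corresponding coset of $\mathfrak{q}$. The messages are $w_k=(w_{k,0},\dots,w_{k,3})\in(\mathcal{O}_L/\mathfrak{q}_k)^4$, $1\le k\le N$; they are encoded as $\mathbf{X}(x)$ with $x_\ell=\mathcal{M}(w_{1,\ell},\dots,w_{N,\ell})$. Let $\mathcal{C}$ be the resulting codebook and, for $\mathcal{S}\subseteq\{1,\dots,N\}$ and given values $v_s$ $(s\in\mathcal{S})$, let $\mathcal{C}_{\mathcal{S}}$ be the subcode of the codewords with $w_s=v_s$ for all $s\in\mathcal{S}$. For $\mathcal{D}=\mathcal{C}$ or $\mathcal{D}=\mathcal{C}_{\mathcal{S}}$ the minimum determinant is that of the (translated) lattice from which $\mathcal{D}$ is carved, $$\delta(\mathcal{D})=\min\bigl\{\det\bigl((X-X')(X-X')^\dagger\bigr): X\ne X'\in\mathcal{D}+\{\mathbf{X}(z):z\in\mathfrak{q}^4\}\bigr\}.$$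 The rate of $w_k$ is $R_k=\frac{1}{32}\log_2\bigl|(\mathcal{O}_L/\mathfrak{q}_k)^4\bigr|$ bits per real symbol, and the normalized side information gain is $$\Gamma(\mathcal{C},\mathcal{S})=\frac{10\log_{10}\bigl(\delta(\mathcal{C}_{\mathcal{S}})/\delta(\mathcal{C})\bigr)}{4\sum_{s\in\mathcal{S}}R_s}.$$ Then for every $\mathcal{S}$ such that $\mathfrak{q}_s\ne\mathcal{O}_L$ for at least one $s\in\mathcal{S}$ (equivalently, $\sum_{s\in\mathcal{S}}R_s>0$), and for all values $v_s$, both minima exist and $$\Gamma(\mathcal{C},\mathcal{S})\ge 20\log_{10}2\approx 6.02\ \text{dB per bit per real symbol}.$$ Moreover, if all $\mathfrak{q}_k$ are principal, then $\Gamma(\mathcal{C},\mathcal{S})=20\log_{10}2$. -/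

import Mathlib

open scoped NumberField

namespace LSTIC

noncomputable section

/-! ### The cyclic extension `L / K` -/

/-- `K = ℚ(i)`, as a subfield of `ℂ`. -/
abbrev K : IntermediateField ℚ ℂ := IntermediateField.adjoin ℚ {Complex.I}

/-- `θ = 2 cos(2π/15) = ζ₁₅ + ζ₁₅⁻¹`. -/
def theta : ℂ := 2 * Complex.cos (2 * Real.pi / 15)

/-- `2 cos(4π/15) = ζ₁₅² + ζ₁₅⁻²`. -/
def theta' : ℂ := 2 * Complex.cos (4 * Real.pi / 15)

/-- `L = K(θ) = ℚ(i, 2 cos(2π/15))`, as a subfield of `ℂ`. -/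
abbrev L : IntermediateField K ℂ := IntermediateField.adjoin K {theta}

lemma theta'_eq : theta' = theta ^ 2 - 2 := by
  have h : (4 * Real.pi / 15 : ℂ) = 2 * (2 * Real.pi / 15) := by ring
  rw [theta', theta, h, Complex.cos_two_mul]
  ring

lemma isIntegral_theta : IsIntegral K theta := by
  have h15 : IsIntegral K (Complex.exp (2 * Real.pi * Complex.I / 15)) := by
    have := (Complex.isPrimitiveRoot_exp 15 (by norm_num)).isIntegral (by norm_num)
    exact_mod_cast this.tower_top
  have h15' : IsIntegral K (Complex.exp (2 * Real.pi * Complex.I / 15))⁻¹ := by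
    have := ((Complex.isPrimitiveRoot_exp 15 (by norm_num)).inv).isIntegral (by norm_num)
    exact_mod_cast this.tower_top
  have h : theta = Complex.exp (2 * Real.pi * Complex.I / 15)
      + (Complex.exp (2 * Real.pi * Complex.I / 15))⁻¹ := by
    rw [theta, Complex.two_cos, ← Complex.exp_neg]
    congr 2 <;> ring
  rw [h]
  exact h15.add h15'

/-- `2 cos(4π/15)` is conjugate to `2 cos(2π/15)` over `ℚ(i)`. -/
lemma aeval_theta' : Polynomial.aeval theta' (minpoly K theta) = 0 := by
  set ζ : ℂ := Complex.exp (2 * Real.pi * Complex.I / 60) with hζ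
  have hprim : IsPrimitiveRoot ζ 60 := by
    have := Complex.isPrimitiveRoot_exp 60 (by norm_num)
    simpa using this
  have hint : IsIntegral ℚ ζ := (hprim.isIntegral (by norm_num)).tower_top
  have hprim' : IsPrimitiveRoot (ζ ^ 17) 60 := hprim.pow_of_coprime 17 (by norm_num)
  have hroot : Polynomial.aeval (ζ ^ 17) (minpoly ℚ ζ) = 0 := by
    rw [← Polynomial.cyclotomic_eq_minpoly_rat hprim (by norm_num),
      Polynomial.cyclotomic_eq_minpoly_rat hprim' (by norm_num)]
    exact minpoly.aeval _ _
  have hI : ζ ^ 15 = Complex.I := by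
    have h : Complex.I = Complex.exp (Real.pi / 2 * Complex.I) :=
      Complex.exp_pi_div_two_mul_I.symm
    rw [h, hζ, ← Complex.exp_nat_mul]
    congr 1
    push_cast
    ring
  have hth : theta = ζ ^ 4 + (ζ ^ 4)⁻¹ := by
    rw [theta, Complex.two_cos, hζ, ← Complex.exp_nat_mul, ← Complex.exp_neg]
    congr 2 <;> (push_cast; ring)
  let E : IntermediateField ℚ ℂ := IntermediateField.adjoin ℚ {ζ}
  let g : E := IntermediateField.AdjoinSimple.gen ℚ ζ
  have hg : (g : ℂ) = ζ := IntermediateField.AdjoinSimple.coe_gen ℚ ζ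
  let φ : E →ₐ[ℚ] ℂ := (IntermediateField.algHomAdjoinIntegralEquiv ℚ hint).symm
    ⟨ζ ^ 17, Polynomial.mem_aroots.2 ⟨minpoly.ne_zero hint, hroot⟩⟩
  have hφg : φ g = ζ ^ 17 :=
    IntermediateField.algHomAdjoinIntegralEquiv_symm_apply_gen ℚ hint _
  have hKE : K ≤ E := by
    rw [IntermediateField.adjoin_simple_le_iff, ← hI]
    exact pow_mem (IntermediateField.mem_adjoin_simple_self ℚ ζ) 15
  let ι : K →ₐ[ℚ] E := IntermediateField.inclusion hKE
  have hfix : φ.comp ι = K.val := by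
    refine IntermediateField.algHom_ext_of_eq_adjoin (S := K) (s := {Complex.I}) _ rfl ?_
    intro x hx
    have hx' : x = Complex.I := hx
    subst hx'
    have h1 : ι ⟨Complex.I, IntermediateField.subset_adjoin ℚ _ hx⟩ = g ^ 15 := by
      apply Subtype.ext
      change Complex.I = ((g ^ 15 : E) : ℂ)
      push_cast
      rw [hg, hI]
    change φ (ι _) = Complex.I
    rw [h1, map_pow, hφg, ← pow_mul, ← hI]
    have h60 := hprim.pow_eq_one
    calc ζ ^ (17 * 15) = (ζ ^ 60) ^ 4 * ζ ^ 15 := by ring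
      _ = ζ ^ 15 := by rw [h60]; ring
  let t : E := g ^ 4 + (g ^ 4)⁻¹
  have ht : (t : ℂ) = theta := by
    change ((g ^ 4 + (g ^ 4)⁻¹ : E) : ℂ) = theta
    push_cast
    rw [hg, hth]
  have hφt : φ t = theta' := by
    have h60 := hprim.pow_eq_one
    have hne : ζ ≠ 0 := Complex.exp_ne_zero _
    have h68 : (ζ ^ 17) ^ 4 = ζ ^ 8 := by
      calc (ζ ^ 17) ^ 4 = ζ ^ 60 * ζ ^ 8 := by ring
        _ = ζ ^ 8 := by rw [h60, one_mul]
    change φ (g ^ 4 + (g ^ 4)⁻¹) = theta'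
    rw [map_add, map_inv₀, map_pow, hφg, h68, theta'_eq, hth]
    field_simp
    ring
  have h0 : Polynomial.eval₂ (ι : K →+* E) t (minpoly K theta) = 0 := by
    have hinj : Function.Injective E.val := E.val.injective
    apply hinj
    rw [map_zero]
    have := Polynomial.hom_eval₂ (minpoly K theta) (ι : K →+* E) (E.val : E →+* ℂ) t
    refine this.trans ?_
    have h2 : ((E.val : E →+* ℂ) t) = theta := ht
    rw [h2]
    exact minpoly.aeval K theta
  have h1 := Polynomial.hom_eval₂ (minpoly K theta) (ι : K →+* E) (φ : E →+* ℂ) t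
  rw [h0, map_zero] at h1
  have h3 : ((φ : E →+* ℂ).comp (ι : K →+* E)) = algebraMap K ℂ := by
    ext x
    exact DFunLike.congr_fun hfix x
  have h4 : (φ : E →+* ℂ) t = theta' := hφt
  rw [h3, h4] at h1
  exact h1.symm

lemma exists_sigma : ∃ σ : L ≃ₐ[K] L,
    ((σ (IntermediateField.AdjoinSimple.gen K theta) : L) : ℂ) = theta' := by
  let f : L →ₐ[K] ℂ := (IntermediateField.algHomAdjoinIntegralEquiv K isIntegral_theta).symm
    ⟨theta', Polynomial.mem_aroots.2 ⟨minpoly.ne_zero isIntegral_theta, aeval_theta'⟩⟩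
  have hf : f (IntermediateField.AdjoinSimple.gen K theta) = theta' :=
    IntermediateField.algHomAdjoinIntegralEquiv_symm_apply_gen K isIntegral_theta _
  have hrange : f.fieldRange ≤ L := by
    have h1 : f.fieldRange = IntermediateField.adjoin K {theta'} := by
      rw [← hf, ← Set.image_singleton, ← IntermediateField.adjoin_map,
        AlgHom.fieldRange_eq_map]
      congr 1
      apply IntermediateField.lift_injective L
      rw [IntermediateField.lift_top, IntermediateField.lift_adjoin_simple,
        IntermediateField.AdjoinSimple.coe_gen]
    rw [h1, IntermediateField.adjoin_simple_le_iff, theta'_eq]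
    exact sub_mem (pow_mem (IntermediateField.mem_adjoin_simple_self K theta) 2)
      (ofNat_mem L 2)
  have : FiniteDimensional K L :=
    IntermediateField.adjoin.finiteDimensional isIntegral_theta
  let f' : L →ₐ[K] L := f.codRestrict L.toSubalgebra fun x => hrange ⟨x, rfl⟩
  exact ⟨AlgEquiv.ofBijective f' f'.bijective, hf⟩

/-- The `K`-automorphism `σ` of `L` with `σ(ζ₁₅ + ζ₁₅⁻¹) = ζ₁₅² + ζ₁₅⁻²` (it is the only one, since
`θ` generates `L` over `K`). -/
def sigma : L ≃ₐ[K] L := Classical.choose exists_sigma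

lemma sigma_theta :
    ((sigma (IntermediateField.AdjoinSimple.gen K theta) : L) : ℂ) = theta' :=
  Classical.choose_spec exists_sigma

/-! ### The `4 × 4` perfect code -/

/-- The non-norm element `γ = i`. -/
def gam : ℂ := Complex.I

lemma alpha_mem : (1 - 3 * Complex.I) + Complex.I * theta ^ 2 ∈ L := by
  have hI : Complex.I ∈ L :=
    L.algebraMap_mem ⟨Complex.I, IntermediateField.mem_adjoin_simple_self ℚ Complex.I⟩
  exact add_mem (sub_mem (one_mem L) (mul_mem (ofNat_mem L 3) hI))
    (mul_mem hI (pow_mem (IntermediateField.mem_adjoin_simple_self K theta) 2))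

/-- `α = (1 - 3i) + i θ²`. -/
def alpha : L := ⟨(1 - 3 * Complex.I) + Complex.I * theta ^ 2, alpha_mem⟩

/-- The diagonal matrix `D(a) = diag(a, σ(a), σ²(a), σ³(a))`. -/
def diagMatrix (a : L) : Matrix (Fin 4) (Fin 4) ℂ :=
  Matrix.diagonal fun m => (((sigma ^ (m : ℕ)) a : L) : ℂ)

/-- The matrix form of the element `x₀ + x₁ e + x₂ e² + x₃ e³` of the cyclic algebra
`(L/K, σ, γ)`: row `m`, column `j` holds `σᵐ(x_{(j - m) mod 4})`, multiplied by `γ` when `j < m`. -/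
def algMatrix (x : Fin 4 → L) : Matrix (Fin 4) (Fin 4) ℂ :=
  Matrix.of fun m j =>
    (if j < m then gam else 1) * (((sigma ^ (m : ℕ)) (x (j - m)) : L) : ℂ)

/-- The codeword of the `4 × 4` perfect code whose layers carry `x₀, …, x₃ ∈ 𝓞_L`. -/
def codeword (x : Fin 4 → 𝓞 L) : Matrix (Fin 4) (Fin 4) ℂ :=
  diagMatrix alpha * algMatrix fun l => (x l : L)

/-! ### Layered space-time index coding -/

section Code

variable {N : ℕ} (q : Fin N → Ideal (𝓞 L))

/-- The `k`-th message `w_k = (w_{k,0}, …, w_{k,3})` ranges over `(𝓞_L / 𝔮_k)⁴`. -/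
abbrev Message (k : Fin N) : Type := Fin 4 → 𝓞 L ⧸ q k

/-- `M` maps `∏ₖ 𝓞_L / 𝔮_k`, which is `𝓞_L / (𝔮₁ ⋯ 𝔮_N)` by the Chinese remainder theorem, to a
complete set of coset leaders in `𝓞_L`: `M u` lies in the coset with residues `u`. -/
def IsCosetLeaderMap (M : (∀ k, 𝓞 L ⧸ q k) → 𝓞 L) : Prop :=
  ∀ u k, Ideal.Quotient.mk (q k) (M u) = u k

variable {q} in
/-- The encoder: layer `l` carries `x_l = M(w_{1,l}, …, w_{N,l})`. -/
def encode (M : (∀ k, 𝓞 L ⧸ q k) → 𝓞 L) (w : ∀ k, Message q k) :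
    Matrix (Fin 4) (Fin 4) ℂ :=
  codeword fun l => M fun k => w k l

variable {q} in
/-- The codebook `C`. -/
def codebook (M : (∀ k, 𝓞 L ⧸ q k) → 𝓞 L) : Set (Matrix (Fin 4) (Fin 4) ℂ) :=
  {X | ∃ w : ∀ k, Message q k, X = encode M w}

variable {q} in
/-- The subcode `C_S` left when the messages `w_s = v_s`, `s ∈ S`, are known. -/
def subcode (M : (∀ k, 𝓞 L ⧸ q k) → 𝓞 L) (S : Finset (Fin N)) (v : ∀ k, Message q k) :
    Set (Matrix (Fin 4) (Fin 4) ℂ) :=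
  {X | ∃ w : ∀ k, Message q k, (∀ s ∈ S, w s = v s) ∧ X = encode M w}

/-- The lattice code from which a set `C` of codewords is carved: a layer symbol stands for its
coset in `𝓞_L / 𝔮`, `𝔮 = 𝔮₁ ⋯ 𝔮_N`, so `C` is a set of representatives of the (translated) lattice
`C + {codeword z | z₀, …, z₃ ∈ 𝔮}`. -/
def latticeCode (C : Set (Matrix (Fin 4) (Fin 4) ℂ)) : Set (Matrix (Fin 4) (Fin 4) ℂ) :=
  {Y | ∃ X ∈ C, ∃ z : Fin 4 → 𝓞 L, (∀ l, z l ∈ ∏ k, q k) ∧ Y = X + codeword z}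

/-- The determinants of `A = (X - X')(X - X')†` for distinct `X, X' ∈ C` (`A` is positive
semidefinite, so `det A` is real). -/
def pairDets (C : Set (Matrix (Fin 4) (Fin 4) ℂ)) : Set ℝ :=
  {d | ∃ X ∈ C, ∃ X' ∈ C, X ≠ X' ∧ d = ((X - X') * (X - X').conjTranspose).det.re}

/-- The minimum determinant `δ(C)` of a code carved from a lattice, that is, the minimum over the
lattice. -/
def minDet (C : Set (Matrix (Fin 4) (Fin 4) ℂ)) : ℝ := sInf (pairDets (latticeCode q C))

/-- The rate `R_k = log₂(M_k) / r` of the `k`-th message in bits per real symbol, where `M_k` is the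
number of values of `w_k` and a codeword carries `r = 2 · 4²` real symbols. -/
def rate (k : Fin N) : ℝ := Real.logb 2 (Nat.card (Message q k)) / (2 * 4 ^ 2)

variable {q} in
/-- The normalized side information gain
`Γ(C, S) = 10 log₁₀(δ(C_S) / δ(C)) / (n_t R_S)`, `n_t = 4`, `R_S = ∑_{s ∈ S} R_s`. -/
def sideInfoGain (M : (∀ k, 𝓞 L ⧸ q k) → 𝓞 L) (S : Finset (Fin N))
    (v : ∀ k, Message q k) : ℝ :=
  10 * Real.logb 10 (minDet q (subcode M S v) / minDet q (codebook M)) /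
    (4 * ∑ s ∈ S, rate q s)

end Code

end

end LSTIC

namespace LSTIC

noncomputable section

/-! Put `a = ∏ s ∈ S, q s`. Differences of points of the lattice code of `C_S` are exactly the
codewords with all symbols in `a`, so `δ(C_S)` is the minimum of `detScale * |nrd z|²` over nonzero
`z ∈ a⁴`; the case `S = ∅`, `a = ⊤` gives `δ(C)` (`pairDets_latticeCode_subcode`).

The reduced norm `nrd z` lies in `K` (`sigma_nrd`) and in `∏ₘ σᵐ(a)` (`nrd_mem`). Taking absolute
norms, `N(a)⁴` divides `(|nrd z|²)⁴`, so `|nrd z|² ≥ N(a)` as soon as `nrd z ≠ 0`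
(`exists_normSq_nrd`). If `a = (g)`, the vector `(g, 0, 0, 0)` attains the bound. Since the rates
over `S` add up to `log₂ N(a) / 8`, the gain is at least `20 log₁₀ 2`, with equality for principal
ideals.

It remains that `nrd z ≠ 0` for `z ≠ 0` (`nrd_ne_zero`), that is, that the cyclic algebra is a
division algebra. The prime `2 + i` is totally ramified in `L`. At the prime above it the residue
field is `𝔽₅`, `σ` acts trivially, and `nrd` reduces to the norm form of the field `𝔽₅[e]`, `e⁴ =
3`. Hence `nrd z = 0` forces every `z l` into all powers of that prime, whose intersection is zero.
-/

instance : FiniteDimensional ℚ K :=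
  IntermediateField.adjoin.finiteDimensional Complex.isIntegral_rat_I

instance : FiniteDimensional K L :=
  IntermediateField.adjoin.finiteDimensional isIntegral_theta

instance : FiniteDimensional ℚ L := Module.Finite.trans K L

instance : NumberField L := ⟨⟩

/-! ### The Galois group of `L / K`, cyclic of order four -/

/-- The minimal polynomial of `2 cos(2π/15)`. -/
lemma theta_quartic : theta ^ 4 - theta ^ 3 - 4 * theta ^ 2 + 4 * theta + 1 = 0 := by
  set w : ℂ := Complex.exp (2 * Real.pi * Complex.I / 15) with hw
  have hprim : IsPrimitiveRoot w 15 := by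
    simpa using Complex.isPrimitiveRoot_exp 15 (by norm_num)
  have hw0 : w ≠ 0 := Complex.exp_ne_zero _
  have hth : theta = w + w⁻¹ := by
    rw [theta, Complex.two_cos, hw, ← Complex.exp_neg]
    congr 2 <;> ring
  have h15 : w ^ 15 = 1 := hprim.pow_eq_one
  have h5 : w ^ 5 - 1 ≠ 0 :=
    sub_ne_zero.2 (hprim.pow_ne_one_of_pos_of_lt (by norm_num) (by norm_num))
  have h3 : w ^ 3 - 1 ≠ 0 :=
    sub_ne_zero.2 (hprim.pow_ne_one_of_pos_of_lt (by norm_num) (by norm_num))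
  have hq : w ^ 2 + w + 1 ≠ 0 := fun h => h3 (by linear_combination (w - 1) * h)
  -- `w ^ 15 - 1 = (w ^ 5 - 1) Φ₃(w) Φ₁₅(w)`, and `Φ₁₅(w) / w ^ 4` is the quartic in `w + w⁻¹`.
  have hphi : w ^ 8 - w ^ 7 + w ^ 5 - w ^ 4 + w ^ 3 - w + 1 = 0 := by
    have : (w ^ 5 - 1) * ((w ^ 2 + w + 1) *
        (w ^ 8 - w ^ 7 + w ^ 5 - w ^ 4 + w ^ 3 - w + 1)) = 0 := by
      linear_combination h15
    simpa [h5, hq] using this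
  rw [hth]
  field_simp
  linear_combination hphi

/-- Irreducibility of the quartic over `ℚ(i)` is not needed: the matching lower bound comes from the
order of `sigma`. -/
lemma finrank_L_le : Module.finrank K L ≤ 4 := by
  have hpoly : (Polynomial.X ^ 4 - Polynomial.X ^ 3 - 4 * Polynomial.X ^ 2 + 4 * Polynomial.X + 1 :
      Polynomial K).natDegree = 4 := by
    compute_degree!
  rw [IntermediateField.adjoin.finrank isIntegral_theta, ← hpoly]
  refine Polynomial.natDegree_le_of_dvd (minpoly.dvd _ _ ?_) ?_
  · simpa [map_ofNat] using theta_quartic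
  · intro h
    simp [h] at hpoly

/-- `θ` as an element of `L`. -/
abbrev thetaL : L := IntermediateField.AdjoinSimple.gen K theta

lemma coe_thetaL : (thetaL : ℂ) = theta := IntermediateField.AdjoinSimple.coe_gen K theta

lemma thetaL_quartic : thetaL ^ 4 - thetaL ^ 3 - 4 * thetaL ^ 2 + 4 * thetaL + 1 = 0 := by
  apply Subtype.ext
  exact theta_quartic

lemma sigma_thetaL : sigma thetaL = thetaL ^ 2 - 2 := by
  apply Subtype.ext
  refine sigma_theta.trans ?_
  rw [theta'_eq, ← coe_thetaL]
  rfl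

lemma algEquiv_ext {f g : L ≃ₐ[K] L} (h : f thetaL = g thetaL) : f = g := by
  have key : f.toAlgHom = g.toAlgHom := by
    refine IntermediateField.algHom_ext_of_eq_adjoin (S := L) (s := {theta}) _ rfl ?_
    intro x hx
    have hx' : x = theta := hx
    subst hx'
    exact h
  exact AlgEquiv.ext fun x => DFunLike.congr_fun key x

/-- The map `t ↦ t ^ 2 - 2` doubles the angle of `2 cos`, and `2 ^ 4 ≡ 1` modulo 15. The cofactor
below is the quotient of the fourth iterate minus `t` by the quartic. -/
lemma sigma_pow_four : sigma ^ 4 = 1 := by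
  apply algEquiv_ext
  have h := thetaL_quartic
  simp only [pow_succ, pow_zero, one_mul, AlgEquiv.mul_apply, AlgEquiv.one_apply, sigma_thetaL,
    map_sub, map_mul, map_ofNat]
  generalize thetaL = t at h ⊢
  linear_combination (t ^ 12 + t ^ 11 - 11 * t ^ 10 - 11 * t ^ 9 + 44 * t ^ 8 + 43 * t ^ 7 - 78
    * t ^ 6 - 71 * t ^ 5 + 61 * t ^ 4 + 46 * t ^ 3 - 20 * t ^ 2 - 9 * t + 2) * h

lemma orderOf_sigma : orderOf sigma = 4 := by
  refine orderOf_eq_prime_pow (p := 2) (n := 1) ?_ sigma_pow_four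
  intro h
  have h2 : (sigma ^ 2) thetaL = thetaL := by rw [show sigma ^ 2 = 1 from h]; rfl
  have h0 := thetaL_quartic
  simp only [pow_succ, pow_zero, one_mul, AlgEquiv.mul_apply, sigma_thetaL, map_sub, map_mul,
    map_ofNat] at h2
  generalize thetaL = t at h0 h2
  -- Euclid's algorithm on the quartic and `σ²(t) - t`: a common root would give `5 = 0`.
  have h3 : t ^ 3 - 5 * t + 1 = 0 := by linear_combination h2 - h0
  have h4 : t ^ 2 - 2 * t + 2 = 0 := by linear_combination h0 - (t - 1) * h3
  have h5 : t + 1 = 0 := by linear_combination (1 / 3) * ((t + 2) * h4 - h3)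
  have h6 : (5 : L) = 0 := by linear_combination h4 - (t - 3) * h5
  norm_num at h6

lemma card_aut_le : Nat.card (L ≃ₐ[K] L) ≤ Module.finrank K L := by
  rw [Nat.card_eq_fintype_card]
  exact AlgEquiv.card_le

lemma four_le_card_aut : 4 ≤ Nat.card (L ≃ₐ[K] L) := by
  rw [← orderOf_sigma]
  exact Nat.le_of_dvd Nat.card_pos (orderOf_dvd_natCard _)

lemma finrank_L : Module.finrank K L = 4 :=
  le_antisymm finrank_L_le (four_le_card_aut.trans card_aut_le)

lemma card_aut : Nat.card (L ≃ₐ[K] L) = 4 :=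
  le_antisymm (card_aut_le.trans finrank_L_le) four_le_card_aut

instance : IsGalois K L := IsGalois.of_card_aut_eq_finrank K L (card_aut.trans finrank_L.symm)

lemma zpowers_sigma : Subgroup.zpowers sigma = ⊤ := by
  rw [← Subgroup.card_eq_iff_eq_top, Nat.card_zpowers, orderOf_sigma, card_aut]

/-- An element of `L` fixed by `σ` lies in `K`. -/
lemma exists_of_sigma_eq {x : L} (hx : sigma x = x) : ∃ k : K, algebraMap K L k = x := by
  refine (IsGalois.mem_range_algebraMap_iff_fixed x).2 fun f => ?_
  have hf : f ∈ Subgroup.zpowers sigma := zpowers_sigma ▸ Subgroup.mem_top f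
  have : Subgroup.zpowers sigma ≤ MulAction.stabilizer (L ≃ₐ[K] L) x := by
    rw [Subgroup.zpowers_le]
    exact hx
  exact this hf

/-! ### Norms of elements of `ℚ(i)` -/

lemma finrank_K_le : Module.finrank ℚ K ≤ 2 := by
  have hpoly : (Polynomial.X ^ 2 + 1 : Polynomial ℚ).natDegree = 2 := by
    compute_degree!
  rw [IntermediateField.adjoin.finrank Complex.isIntegral_rat_I, ← hpoly]
  refine Polynomial.natDegree_le_of_dvd (minpoly.dvd _ _ ?_) ?_
  · simp
  · intro h
    simp [h] at hpoly

lemma norm_eq_mul_of_finrank_le_two {F E Ω : Type*} [Field F] [Field E] [Field Ω] [Algebra F E]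
    [Algebra F Ω] [FiniteDimensional F E] [Algebra.IsSeparable F E] [IsAlgClosed Ω]
    (h2 : Module.finrank F E ≤ 2) {f g : E →ₐ[F] Ω} (hfg : f ≠ g) (x : E) :
    algebraMap F Ω (Algebra.norm F x) = f x * g x := by
  classical
  have huniv : ({f, g} : Finset (E →ₐ[F] Ω)) = Finset.univ := by
    refine Finset.eq_of_subset_of_card_le (Finset.subset_univ _) ?_
    rw [Finset.card_pair hfg, Finset.card_univ, AlgHom.card]
    exact h2
  rw [Algebra.norm_eq_prod_embeddings F Ω x, ← huniv, Finset.prod_pair hfg]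

/-- The norm of `ℚ(i) / ℚ` is the square of the absolute value. -/
lemma norm_K (k : K) : ((Algebra.norm ℚ k : ℚ) : ℝ) = Complex.normSq (k : ℂ) := by
  let c : K →ₐ[ℚ] ℂ := (Complex.conjAe.toAlgHom.restrictScalars ℚ).comp K.val
  let i : K := ⟨Complex.I, IntermediateField.mem_adjoin_simple_self ℚ Complex.I⟩
  have hne : K.val ≠ c := fun h => by
    have h2 : Complex.I = (starRingEnd ℂ) Complex.I := DFunLike.congr_fun h i
    rw [Complex.conj_I, self_eq_neg] at h2
    exact Complex.I_ne_zero h2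
  have h' : ((Algebra.norm ℚ k : ℚ) : ℂ) = (k : ℂ) * (starRingEnd ℂ) (k : ℂ) :=
    norm_eq_mul_of_finrank_le_two finrank_K_le hne k
  rw [Complex.mul_conj] at h'
  exact_mod_cast h'

/-- The inclusion of `𝓞_L` in `ℂ`. -/
def toComplex : 𝓞 L →+* ℂ := (algebraMap L ℂ).comp (algebraMap (𝓞 L) L)

lemma toComplex_apply (x : 𝓞 L) : toComplex x = ((x : L) : ℂ) := rfl

lemma toComplex_injective : Function.Injective toComplex := fun _ _ h =>
  NumberField.RingOfIntegers.ext (Subtype.ext h)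

/-- An integer `d` of `L` that lies in `ℚ(i)` has `|N_{L/ℚ}(d)| = (|d|²)⁴`, and `|d|²` is a natural
number. -/
lemma exists_normSq_eq {d : 𝓞 L} (hd : sigma d = d) :
    ∃ n : ℕ, Complex.normSq (toComplex d) = n ∧ Ideal.absNorm (Ideal.span {d}) = n ^ 4 := by
  obtain ⟨k, hk⟩ := exists_of_sigma_eq hd
  have hkint : IsIntegral ℤ k :=
    (isIntegral_algebraMap_iff (algebraMap K L).injective).1 (hk ▸ d.isIntegral_coe)
  obtain ⟨z, hz⟩ := IsIntegrallyClosed.isIntegral_iff.1 (Algebra.isIntegral_norm ℚ hkint)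
  have hz' : (z : ℚ) = Algebra.norm ℚ k := hz
  have hnorm : ((z : ℤ) : ℝ) = Complex.normSq (toComplex d) := by
    have h1 : toComplex d = (k : ℂ) := by rw [toComplex_apply, ← hk]; rfl
    rw [h1, ← norm_K, ← hz']
    norm_cast
  have hz0 : 0 ≤ z := by
    have := hnorm ▸ Complex.normSq_nonneg (toComplex d)
    exact_mod_cast this
  lift z to ℕ using hz0
  refine ⟨z, by rw [← hnorm]; norm_cast, ?_⟩
  have h2 : Algebra.norm ℤ d = (z : ℤ) ^ 4 := by
    have : ((Algebra.norm ℤ d : ℤ) : ℚ) = (z : ℚ) ^ 4 := by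
      rw [Algebra.coe_norm_int, ← hk, ← Algebra.norm_norm (S := K), Algebra.norm_algebraMap,
        finrank_L, map_pow, ← hz']
      norm_cast
    exact_mod_cast this
  rw [Ideal.absNorm_span_singleton, h2]
  norm_cast

/-! ### The reduced norm and its divisibility by ideals -/

/-- The automorphism `σᵐ` of `𝓞_L`. -/
def sigmaInt (m : ℕ) : 𝓞 L ≃+* 𝓞 L :=
  NumberField.RingOfIntegers.mapRingEquiv (sigma ^ m : L ≃ₐ[K] L).toRingEquiv

@[simp]
lemma coe_sigmaInt (m : ℕ) (x : 𝓞 L) : ((sigmaInt m x : 𝓞 L) : L) = (sigma ^ m) (x : L) := rfl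

lemma sigmaInt_zero (x : 𝓞 L) : sigmaInt 0 x = x := rfl

lemma sigmaInt_sigmaInt (m n : ℕ) (x : 𝓞 L) : sigmaInt m (sigmaInt n x) = sigmaInt (m + n) x := by
  apply NumberField.RingOfIntegers.ext
  rw [coe_sigmaInt, coe_sigmaInt, coe_sigmaInt, pow_add, AlgEquiv.mul_apply]

lemma sigmaInt_four (x : 𝓞 L) : sigmaInt 4 x = x := by
  apply NumberField.RingOfIntegers.ext
  rw [coe_sigmaInt, sigma_pow_four, AlgEquiv.one_apply]

/-- `i` as an element of `K`. -/
def iK : K := ⟨Complex.I, IntermediateField.mem_adjoin_simple_self ℚ Complex.I⟩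

lemma iK_sq : iK ^ 2 = -1 := Subtype.ext Complex.I_sq

/-- `i` as an element of `𝓞_L`. -/
def iInt : 𝓞 L := ⟨algebraMap K L iK, by
  refine IsIntegral.algebraMap ⟨Polynomial.X ^ 2 + 1, by monicity!, ?_⟩
  simp [iK_sq]⟩

lemma iInt_sq : iInt ^ 2 = -1 := by
  apply NumberField.RingOfIntegers.ext
  change (algebraMap K L iK) ^ 2 = _
  rw [← map_pow, iK_sq]
  simp

lemma iInt_ne_zero : iInt ≠ 0 := fun h => by
  have := iInt_sq
  simp [h] at this

@[simp]
lemma sigmaInt_iInt (m : ℕ) : sigmaInt m iInt = iInt :=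
  NumberField.RingOfIntegers.ext (AlgEquiv.commutes (sigma ^ m) iK)

/-- `algMatrix` with entries in `𝓞_L`. -/
def intMatrix (x : Fin 4 → 𝓞 L) : Matrix (Fin 4) (Fin 4) (𝓞 L) :=
  Matrix.of fun m j => (if j < m then iInt else 1) * sigmaInt m (x (j - m))

lemma intMatrix_apply (x : Fin 4 → 𝓞 L) (m j : Fin 4) :
    intMatrix x m j = (if j < m then iInt else 1) * sigmaInt m (x (j - m)) := rfl

/-- The reduced norm of `x₀ + x₁ e + x₂ e² + x₃ e³`. -/
def nrd (x : Fin 4 → 𝓞 L) : 𝓞 L := (intMatrix x).det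

lemma algMatrix_eq (x : Fin 4 → 𝓞 L) :
    algMatrix (fun l => (x l : L)) = (intMatrix x).map toComplex := by
  ext m j
  rw [Matrix.map_apply, intMatrix_apply, map_mul, apply_ite toComplex, map_one]
  rfl

lemma det_codeword (x : Fin 4 → 𝓞 L) :
    (codeword x).det = (diagMatrix alpha).det * toComplex (nrd x) := by
  rw [codeword, Matrix.det_mul, algMatrix_eq, nrd, RingHom.map_det]
  rfl

lemma codeword_add (x y : Fin 4 → 𝓞 L) : codeword (x + y) = codeword x + codeword y := by
  rw [codeword, codeword, codeword, ← mul_add, algMatrix_eq, algMatrix_eq, algMatrix_eq]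
  congr 1
  ext m j
  simp only [Matrix.add_apply, Matrix.map_apply, intMatrix_apply, Pi.add_apply, map_add, map_mul,
    mul_add]

lemma codeword_sub (x y : Fin 4 → 𝓞 L) : codeword x - codeword y = codeword (x - y) := by
  rw [sub_eq_iff_eq_add, ← codeword_add, sub_add_cancel]

/-- The reduced norm lies in `ℚ(i)`. -/
lemma sigma_nrd (x : Fin 4 → 𝓞 L) : sigma (nrd x) = nrd x := by
  suffices h : sigmaInt 1 (nrd x) = nrd x by
    have := congrArg (fun y : 𝓞 L => (y : L)) h
    simpa using this
  -- Applying `σ` moves each entry one place along its diagonal, cyclically; `D` supplies the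
  -- factors `i` where a row or column index wraps around.
  let D : Matrix (Fin 4) (Fin 4) (𝓞 L) := Matrix.diagonal ![1, 1, 1, iInt]
  have hD : D.det = iInt := by simp [D, Fin.prod_univ_four]
  let e : Fin 4 ≃ Fin 4 := Equiv.addRight 1
  have hs : sigmaInt 1 (nrd x) = ((intMatrix x).map (sigmaInt 1)).det :=
    RingHom.map_det (sigmaInt 1 : 𝓞 L →+* 𝓞 L) _
  have hmul : D * (intMatrix x).submatrix e e = (intMatrix x).map (sigmaInt 1) * D := by
    ext m j : 1
    rw [Matrix.diagonal_mul, Matrix.mul_diagonal, Matrix.submatrix_apply, Matrix.map_apply,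
      intMatrix_apply, intMatrix_apply, map_mul, sigmaInt_sigmaInt]
    have hsub : e j - e m = j - m := by simp [e]
    rw [hsub]
    generalize x (j - m) = y
    fin_cases m <;> fin_cases j <;>
      simp [e, sigmaInt_four, sigmaInt_zero, mul_comm]
  have hdet := congrArg Matrix.det hmul
  rw [Matrix.det_mul, Matrix.det_mul, Matrix.det_submatrix_equiv_self, hD, ← hs, mul_comm] at hdet
  exact (mul_right_cancel₀ iInt_ne_zero hdet).symm

lemma nrd_mul (c : 𝓞 L) (x : Fin 4 → 𝓞 L) :
    nrd (fun l => c * x l) = (∏ m : Fin 4, sigmaInt m c) * nrd x := by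
  have h : intMatrix (fun l => c * x l) =
      Matrix.diagonal (fun m : Fin 4 => sigmaInt m c) * intMatrix x := by
    ext m j : 1
    rw [Matrix.diagonal_mul, intMatrix_apply, intMatrix_apply, map_mul]
    ring
  rw [nrd, h, Matrix.det_mul, Matrix.det_diagonal, nrd]

lemma nrd_single_one : nrd (Pi.single 0 1) = 1 := by
  have h : intMatrix (Pi.single 0 1) = 1 := by
    ext m j : 1
    rw [intMatrix_apply]
    fin_cases m <;> fin_cases j <;> simp
  rw [nrd, h, Matrix.det_one]

lemma absNorm_map_sigmaInt (m : ℕ) (a : Ideal (𝓞 L)) :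
    Ideal.absNorm (a.map (sigmaInt m)) = Ideal.absNorm a := by
  rw [Ideal.absNorm_apply, Ideal.absNorm_apply]
  exact (Nat.card_congr (Ideal.quotientEquiv a (a.map (sigmaInt m)) (sigmaInt m) rfl).toEquiv).symm

lemma absNorm_prod_map_sigmaInt (a : Ideal (𝓞 L)) :
    Ideal.absNorm (∏ m : Fin 4, a.map (sigmaInt m)) = Ideal.absNorm a ^ 4 := by
  simp [absNorm_map_sigmaInt]

/-- Row `m` has entries in `σᵐ(a)`, and each Leibniz term takes one entry from every row. The
transpose makes the product in `Matrix.det_apply` run over rows. -/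
lemma nrd_mem {a : Ideal (𝓞 L)} {x : Fin 4 → 𝓞 L} (hx : ∀ l, x l ∈ a) :
    nrd x ∈ ∏ m : Fin 4, a.map (sigmaInt m) := by
  rw [nrd, ← Matrix.det_transpose, Matrix.det_apply]
  refine Ideal.sum_mem _ fun π _ => ?_
  refine Submodule.smul_of_tower_mem _ _ (Ideal.prod_mem_prod fun m _ => ?_)
  rw [Matrix.transpose_apply, intMatrix_apply]
  exact Ideal.mul_mem_left _ _ (Ideal.mem_map_of_mem _ (hx _))

/-- `|nrd x|²` is a natural number, at least the norm of any ideal containing the `x_l`. -/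
lemma exists_normSq_nrd {a : Ideal (𝓞 L)} {x : Fin 4 → 𝓞 L} (hx : ∀ l, x l ∈ a)
    (h0 : nrd x ≠ 0) :
    ∃ n : ℕ, Complex.normSq (toComplex (nrd x)) = n ∧ Ideal.absNorm a ≤ n := by
  obtain ⟨n, hn, hn4⟩ := exists_normSq_eq (sigma_nrd x)
  refine ⟨n, hn, ?_⟩
  have hdvd := Ideal.absNorm_dvd_absNorm_of_le ((Ideal.span_singleton_le_iff_mem _).2 (nrd_mem hx))
  rw [absNorm_prod_map_sigmaInt, hn4] at hdvd
  have hn0 : 0 < n := by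
    refine Nat.pos_of_ne_zero fun h => h0 ?_
    rw [h, Nat.cast_zero, Complex.normSq_eq_zero, ← map_zero toComplex] at hn
    exact toComplex_injective hn
  exact (Nat.pow_le_pow_iff_left (by norm_num)).1 (Nat.le_of_dvd (by positivity) hdvd)

/-- With one nonzero symbol `g` in layer 0 the reduced norm is `N_{L/K}(g)`; this is the vector
attaining the minimum for a principal ideal. -/
lemma normSq_nrd_mul_single (g : 𝓞 L) :
    Complex.normSq (toComplex (nrd fun l => g * (Pi.single 0 1 : Fin 4 → 𝓞 L) l)) =
      Ideal.absNorm (Ideal.span {g}) := by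
  obtain ⟨n, hn, hn4⟩ := exists_normSq_eq
    (sigma_nrd fun l => g * (Pi.single 0 1 : Fin 4 → 𝓞 L) l)
  rw [hn]
  rw [nrd_mul, nrd_single_one, mul_one] at hn4
  have h : Ideal.span {∏ m : Fin 4, sigmaInt m g} =
      ∏ m : Fin 4, (Ideal.span {g}).map (sigmaInt m) := by
    simp only [Ideal.map_span, Set.image_singleton, Ideal.prod_span_singleton]
  rw [h, absNorm_prod_map_sigmaInt] at hn4
  exact_mod_cast ((Nat.pow_left_injective (n := 4) (by norm_num)) hn4).symm

/-! ### The ramified prime above `2 + i` -/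

/-- `θ` as an element of `𝓞_L`. -/
def thetaInt : 𝓞 L := ⟨thetaL, by
  refine ⟨Polynomial.X ^ 4 - Polynomial.X ^ 3 - 4 * Polynomial.X ^ 2 + 4 * Polynomial.X + 1,
    by monicity!, ?_⟩
  simpa [Polynomial.eval₂_ofNat] using thetaL_quartic⟩

lemma thetaInt_quartic :
    thetaInt ^ 4 - thetaInt ^ 3 - 4 * thetaInt ^ 2 + 4 * thetaInt + 1 = 0 := by
  apply NumberField.RingOfIntegers.ext
  simp only [map_add, map_sub, map_mul, map_pow, map_one, map_zero, map_ofNat]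
  exact thetaL_quartic

lemma sigmaInt_one_thetaInt : sigmaInt 1 thetaInt = thetaInt ^ 2 - 2 := by
  apply NumberField.RingOfIntegers.ext
  simp only [map_sub, map_pow, map_ofNat]
  exact sigma_thetaL

/-- The relative norm of `θ + 1`. -/
lemma prod_sigmaInt_thetaInt_add_one : ∏ m : Fin 4, sigmaInt m (thetaInt + 1) = -5 := by
  have h0 := thetaInt_quartic
  have h1 := sigmaInt_one_thetaInt
  have h2 : sigmaInt 2 thetaInt = (thetaInt ^ 2 - 2) ^ 2 - 2 := by
    rw [← sigmaInt_sigmaInt 1 1, h1, map_sub, map_pow, h1, map_ofNat]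
  have h3 : sigmaInt 3 thetaInt = ((thetaInt ^ 2 - 2) ^ 2 - 2) ^ 2 - 2 := by
    rw [← sigmaInt_sigmaInt 1 2, h2, map_sub, map_pow, map_sub, map_pow, h1, map_ofNat]
  rw [Fin.prod_univ_four]
  simp only [Fin.val_zero, Fin.val_one, Fin.val_two, show ((3 : Fin 4) : ℕ) = 3 from rfl,
    sigmaInt_zero, map_add, map_one, h1, h2, h3]
  generalize thetaInt = t at h0 ⊢
  -- The value `-5` is the quartic at `-1`; the cofactor comes from polynomial division by the
  -- quartic.
  linear_combination (t ^ 11 + 2 * t ^ 10 - 7 * t ^ 9 - 16 * t ^ 8 + 14 * t ^ 7 + 43 * t ^ 6 - 5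
    * t ^ 5 - 48 * t ^ 4 - 7 * t ^ 3 + 25 * t ^ 2 + 7 * t - 4) * h0

lemma toComplex_iInt : toComplex iInt = Complex.I := rfl

lemma absNorm_span_of_normSq {d : 𝓞 L} (hd : sigmaInt 1 d = d) {n : ℕ}
    (hn : Complex.normSq (toComplex d) = n) : Ideal.absNorm (Ideal.span {d}) = n ^ 4 := by
  obtain ⟨k, hk, hk4⟩ := exists_normSq_eq (d := d)
    (by simpa using congrArg (fun y : 𝓞 L => (y : L)) hd)
  rw [hk4, ← Nat.cast_injective (hn.symm.trans hk)]

lemma absNorm_span_thetaInt_add_one : Ideal.absNorm (Ideal.span {thetaInt + 1}) = 25 := by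
  have h : Ideal.span {(-5 : 𝓞 L)} =
      ∏ m : Fin 4, (Ideal.span {thetaInt + 1}).map (sigmaInt m) := by
    simp only [Ideal.map_span, Set.image_singleton, Ideal.prod_span_singleton,
      prod_sigmaInt_thetaInt_add_one]
  have h25 : Ideal.absNorm (Ideal.span {(-5 : 𝓞 L)}) = 25 ^ 4 :=
    absNorm_span_of_normSq (by simp [map_ofNat]) (by simp [map_ofNat]; norm_num)
  rw [h, absNorm_prod_map_sigmaInt] at h25
  exact (Nat.pow_left_injective (n := 4) (by norm_num)) h25

lemma span_two_add_ne_top : Ideal.span {2 + iInt} ≠ ⊤ := by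
  have h : Ideal.absNorm (Ideal.span {2 + iInt}) = 5 ^ 4 :=
    absNorm_span_of_normSq (by simp [map_ofNat])
      (by simp [map_ofNat, toComplex_iInt, Complex.normSq_apply]; norm_num)
  intro ht
  simp [ht] at h

lemma span_two_sub_ne_top : Ideal.span {2 - iInt} ≠ ⊤ := by
  have h : Ideal.absNorm (Ideal.span {2 - iInt}) = 5 ^ 4 :=
    absNorm_span_of_normSq (by simp [map_ofNat])
      (by simp [map_ofNat, toComplex_iInt, Complex.normSq_apply]; norm_num)
  intro ht
  simp [ht] at h

lemma two_add_mul_two_sub : (2 + iInt) * (2 - iInt) = 5 := by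
  linear_combination -iInt_sq

/-- A prime of `𝓞_L` above `2 + i`. -/
def ramPrime : Ideal (𝓞 L) := Ideal.span {thetaInt + 1, 2 + iInt}

lemma thetaInt_add_one_mem : thetaInt + 1 ∈ ramPrime := Ideal.subset_span (by simp)

lemma two_add_mem : 2 + iInt ∈ ramPrime := Ideal.subset_span (by simp)

/-- Modulo 5 the quartic is `(t + 1) ^ 4`, so every maximal ideal containing `2 + i` contains `θ +
1`. -/
lemma ramPrime_ne_top : ramPrime ≠ ⊤ := by
  obtain ⟨P, hP, hle⟩ := Ideal.exists_le_maximal _ span_two_add_ne_top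
  have h2 : 2 + iInt ∈ P := hle (Ideal.mem_span_singleton_self _)
  have hpow : (thetaInt + 1) ^ 4 ∈ P := by
    have : (thetaInt + 1) ^ 4 =
        (thetaInt ^ 3 + 2 * thetaInt ^ 2) * (2 - iInt) * (2 + iInt) := by
      linear_combination thetaInt_quartic -
        (thetaInt ^ 3 + 2 * thetaInt ^ 2) * two_add_mul_two_sub
    rw [this]
    exact Ideal.mul_mem_left _ _ h2
  have h1 : thetaInt + 1 ∈ P := hP.isPrime.mem_of_pow_mem 4 hpow
  refine fun ht => hP.ne_top (top_le_iff.1 (ht ▸ ?_))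
  rw [ramPrime, Ideal.span_le]
  rintro x (rfl | rfl)
  exacts [h1, h2]

/-- Otherwise `θ + 1` divides `2 + i`, and relative norms show that `5` divides `(2 + i) ^ 4`. A
prime above `2 - i` would then contain `2 + i`, hence `4` and `5`. -/
lemma ramPrime_ne_span : ramPrime ≠ Ideal.span {thetaInt + 1} := by
  intro h
  obtain ⟨y, hy⟩ := Ideal.mem_span_singleton'.1 (h ▸ two_add_mem)
  have hprod : (∏ m : Fin 4, sigmaInt m y) * (-5) = (2 + iInt) ^ 4 := by
    rw [← prod_sigmaInt_thetaInt_add_one, ← Finset.prod_mul_distrib]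
    simp only [← map_mul, hy]
    simp [map_ofNat]
  obtain ⟨P, hP, hle⟩ := Ideal.exists_le_maximal _ span_two_sub_ne_top
  have hm : 2 - iInt ∈ P := hle (Ideal.mem_span_singleton_self _)
  have h5 : (5 : 𝓞 L) ∈ P := two_add_mul_two_sub ▸ Ideal.mul_mem_left _ _ hm
  have hp : 2 + iInt ∈ P := by
    refine hP.isPrime.mem_of_pow_mem 4 ?_
    rw [← hprod]
    exact Ideal.mul_mem_left _ _ (P.neg_mem h5)
  refine hP.ne_top ((Ideal.eq_top_iff_one P).2 ?_)
  have := P.sub_mem h5 (P.add_mem hp hm)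
  ring_nf at this
  exact this

lemma absNorm_ramPrime : Ideal.absNorm ramPrime = 5 := by
  have hle : Ideal.span {thetaInt + 1} ≤ ramPrime :=
    (Ideal.span_singleton_le_iff_mem _).2 thetaInt_add_one_mem
  obtain ⟨J, hJ⟩ := Ideal.dvd_iff_le.2 hle
  have hmul : Ideal.absNorm ramPrime * Ideal.absNorm J = 5 ^ 2 := by
    rw [← map_mul, ← hJ, absNorm_span_thetaInt_add_one]
    norm_num
  obtain ⟨k, hk, hk'⟩ := (Nat.dvd_prime_pow Nat.prime_five).1 (Dvd.intro _ hmul)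
  interval_cases k
  · exact absurd (Ideal.absNorm_eq_one_iff.1 (by simpa using hk')) ramPrime_ne_top
  · simpa using hk'
  · rw [hk'] at hmul
    have hJ1 : Ideal.absNorm J = 1 := by linarith
    rw [Ideal.absNorm_eq_one_iff.1 hJ1, Ideal.mul_top] at hJ
    exact absurd hJ.symm ramPrime_ne_span

instance : ramPrime.IsPrime := Ideal.isPrime_of_irreducible_absNorm
  (absNorm_ramPrime ▸ Nat.prime_five)

lemma sigmaInt_one_mem {x : 𝓞 L} (hx : x ∈ ramPrime) : sigmaInt 1 x ∈ ramPrime := by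
  suffices h : ramPrime ≤ ramPrime.comap (sigmaInt 1) from h hx
  conv_lhs => rw [ramPrime]
  rw [Ideal.span_le]
  rintro y (rfl | rfl)
  · have : sigmaInt 1 (thetaInt + 1) = (thetaInt - 1) * (thetaInt + 1) := by
      rw [map_add, map_one, sigmaInt_one_thetaInt]
      ring
    change sigmaInt 1 (thetaInt + 1) ∈ ramPrime
    exact this ▸ Ideal.mul_mem_left _ _ thetaInt_add_one_mem
  · have : sigmaInt 1 (2 + iInt) = 2 + iInt := by simp [map_ofNat]
    change sigmaInt 1 (2 + iInt) ∈ ramPrime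
    rw [this]
    exact two_add_mem

/-! ### Reduction modulo `ramPrime` and the division property -/

/-- The residue map `𝓞_L → 𝔽₅` at `ramPrime`. -/
lemma exists_residueMap : ∃ φ : 𝓞 L →+* ZMod 5, RingHom.ker φ = ramPrime := by
  have hcard : Nat.card (𝓞 L ⧸ ramPrime) = 5 := absNorm_ramPrime
  have : Finite (𝓞 L ⧸ ramPrime) := Nat.finite_of_card_ne_zero (by rw [hcard]; norm_num)
  have := Fintype.ofFinite (𝓞 L ⧸ ramPrime)
  rw [Nat.card_eq_fintype_card] at hcard
  let e := (ZMod.ringEquivOfPrime (𝓞 L ⧸ ramPrime) Nat.prime_five hcard).symm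
  refine ⟨(e : (𝓞 L ⧸ ramPrime) →+* ZMod 5).comp (Ideal.Quotient.mk ramPrime), ?_⟩
  ext x
  simp [RingHom.mem_ker, Ideal.Quotient.eq_zero_iff_mem]

/-- `σ` acts trivially on the residue field of `ramPrime`. -/
lemma residueMap_sigmaInt {φ : 𝓞 L →+* ZMod 5} (hφ : RingHom.ker φ = ramPrime) (m : ℕ) (x : 𝓞 L) :
    φ (sigmaInt m x) = φ x := by
  have h1 : ∀ y, φ (sigmaInt 1 y) = φ y := fun y => by
    -- Every residue class contains a natural number, which `σ` fixes.
    have hy : y - ((φ y).val : 𝓞 L) ∈ ramPrime := by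
      rw [← hφ, RingHom.mem_ker, map_sub, map_natCast, ZMod.natCast_zmod_val, sub_self]
    have hy' := sigmaInt_one_mem hy
    rw [← hφ, RingHom.mem_ker, map_sub, map_natCast, map_sub, map_natCast,
      ZMod.natCast_zmod_val, sub_eq_zero] at hy'
    exact hy'
  induction m with
  | zero => rw [sigmaInt_zero]
  | succ k ih => rw [← sigmaInt_sigmaInt, ← ih, ← h1 (sigmaInt k x), sigmaInt_sigmaInt,
      sigmaInt_sigmaInt, add_comm]

/-- `3` is not a square modulo 5. -/
lemma sq_sub_three_mul_sq : ∀ p r : ZMod 5, p ^ 2 - 3 * r ^ 2 = 0 → p = 0 ∧ r = 0 := by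
  decide

/-- With `e ^ 4 = 3`, the two expressions are the coordinates of the norm `(a + c e²)² - e² (b + d
e²)²` from the field `𝔽₅[e]` to `𝔽₅[e²]`. -/
lemma eq_zero_of_norm_coeffs : ∀ a b c d : ZMod 5,
    a ^ 2 + 3 * c ^ 2 - 6 * (b * d) = 0 → 2 * (a * c) - b ^ 2 - 3 * d ^ 2 = 0 →
      a = 0 ∧ b = 0 ∧ c = 0 ∧ d = 0 := by
  decide

/-- Modulo `ramPrime` the twist by `σ` disappears and `i` becomes `3`, so the determinant is the
norm form of `𝔽₅[e] / 𝔽₅`, split into two quadratic steps. -/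
lemma mem_of_nrd_mem {x : Fin 4 → 𝓞 L} (h : nrd x ∈ ramPrime) (l : Fin 4) : x l ∈ ramPrime := by
  obtain ⟨φ, hφ⟩ := exists_residueMap
  have hi : φ iInt = 3 := by
    have := two_add_mem
    rw [← hφ, RingHom.mem_ker, map_add, map_ofNat] at this
    rw [eq_neg_of_add_eq_zero_right this]
    decide
  have hM : (intMatrix x).map φ = !![φ (x 0), φ (x 1), φ (x 2), φ (x 3);
      3 * φ (x 3), φ (x 0), φ (x 1), φ (x 2); 3 * φ (x 2), 3 * φ (x 3), φ (x 0), φ (x 1);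
      3 * φ (x 1), 3 * φ (x 2), 3 * φ (x 3), φ (x 0)] := by
    ext m j
    rw [Matrix.map_apply, intMatrix_apply, map_mul, residueMap_sigmaInt hφ, apply_ite φ, hi,
      map_one]
    fin_cases m <;> fin_cases j <;> simp <;> rfl
  have hdet : ((intMatrix x).map φ).det = 0 := by
    rw [← hφ, RingHom.mem_ker, nrd, RingHom.map_det] at h
    exact h
  rw [hM] at hdet
  have hform := sq_sub_three_mul_sq
    (φ (x 0) ^ 2 + 3 * φ (x 2) ^ 2 - 6 * (φ (x 1) * φ (x 3)))
    (2 * (φ (x 0) * φ (x 2)) - φ (x 1) ^ 2 - 3 * φ (x 3) ^ 2) (by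
      rw [← hdet, Matrix.det_succ_row_zero]
      simp only [Fin.sum_univ_four, Matrix.det_fin_three]
      simp [Fin.succAbove]
      ring)
  obtain ⟨h0, h1, h2, h3⟩ := eq_zero_of_norm_coeffs _ _ _ _ hform.1 hform.2
  rw [← hφ, RingHom.mem_ker]
  fin_cases l
  exacts [h0, h1, h2, h3]

lemma two_sub_notMem : 2 - iInt ∉ ramPrime := by
  intro hm
  refine ramPrime_ne_top ((Ideal.eq_top_iff_one _).2 ?_)
  have h5 : (5 : 𝓞 L) ∈ ramPrime := two_add_mul_two_sub ▸ Ideal.mul_mem_left _ _ hm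
  have := ramPrime.sub_mem h5 (ramPrime.add_mem two_add_mem hm)
  ring_nf at this
  exact this

/-- `(θ + 1)` is `ramPrime` times a prime above `2 - i`, and the factor `2 - i` absorbs the latter.
Thus `θ + 1` serves as a uniformizer up to a factor outside `ramPrime`. -/
lemma exists_mul_eq {x : 𝓞 L} (hx : x ∈ ramPrime) : ∃ y, (2 - iInt) * x = (thetaInt + 1) * y := by
  obtain ⟨u, w, rfl⟩ := Ideal.mem_span_pair.1 hx
  have h5 : (thetaInt + 1) ∣ (5 : 𝓞 L) := by
    rw [← neg_neg (5 : 𝓞 L), ← prod_sigmaInt_thetaInt_add_one, dvd_neg]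
    exact Finset.dvd_prod_of_mem (fun m : Fin 4 => sigmaInt m (thetaInt + 1)) (Finset.mem_univ 0)
  obtain ⟨c, hc⟩ := h5
  refine ⟨(2 - iInt) * u + w * c, ?_⟩
  linear_combination w * two_add_mul_two_sub + w * hc

/-- Descent: `(2 - i) x = (θ + 1) y` with `nrd y = 0` again, so each round gains one power of
`ramPrime`. -/
lemma mem_pow_of_nrd_eq_zero (n : ℕ) :
    ∀ x : Fin 4 → 𝓞 L, nrd x = 0 → ∀ l, x l ∈ ramPrime ^ n := by
  induction n with
  | zero => simp
  | succ n ih =>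
    intro x hx l
    choose y hy using fun l => exists_mul_eq (mem_of_nrd_mem (hx ▸ ramPrime.zero_mem) l)
    have hy0 : nrd y = 0 := by
      have h : nrd (fun l => (thetaInt + 1) * y l) = 0 := by
        simp only [← hy]
        rw [nrd_mul, hx, mul_zero]
      rw [nrd_mul, prod_sigmaInt_thetaInt_add_one] at h
      simpa using h
    have hmem : (2 - iInt) * x l ∈ ramPrime ^ (n + 1) := by
      rw [hy, pow_succ']
      exact Ideal.mul_mem_mul thetaInt_add_one_mem (ih y hy0 l)
    exact (Ideal.IsPrime.mul_mem_pow _ hmem).resolve_left two_sub_notMem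

/-- The cyclic algebra `(L/K, σ, i)` is a division algebra. -/
lemma nrd_ne_zero {x : Fin 4 → 𝓞 L} (hx : x ≠ 0) : nrd x ≠ 0 := by
  intro h
  refine hx (funext fun l => ?_)
  have : x l ∈ ⨅ n : ℕ, ramPrime ^ n :=
    Ideal.mem_iInf.2 fun n => mem_pow_of_nrd_eq_zero n x h l
  rwa [Ideal.iInf_pow_eq_bot_of_isDomain _ ramPrime_ne_top] at this

/-! ### Determinants of codewords and their minimum over an ideal -/

lemma alpha_ne_zero : alpha ≠ 0 := by
  intro h
  have h' : (1 - 3 * Complex.I) + Complex.I * theta ^ 2 = 0 := congrArg Subtype.val h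
  -- As `θ` is real, the real part of `α` is `1`.
  have hre : theta = ((2 * Real.cos (2 * Real.pi / 15) : ℝ) : ℂ) := by
    rw [theta]
    push_cast
    rfl
  rw [hre, ← Complex.ofReal_pow] at h'
  generalize (2 * Real.cos (2 * Real.pi / 15)) ^ 2 = r at h'
  have := congrArg Complex.re h'
  simp at this

lemma det_diagMatrix_alpha_ne_zero : (diagMatrix alpha).det ≠ 0 := by
  rw [diagMatrix, Matrix.det_diagonal, Finset.prod_ne_zero_iff]
  intro m _ h
  have : (sigma ^ (m : ℕ)) alpha = 0 := Subtype.ext h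
  exact alpha_ne_zero ((map_eq_zero_iff _ (sigma ^ (m : ℕ)).injective).1 this)

/-- The factor `|N_{L/K}(α)|²` common to all determinants. -/
def detScale : ℝ := Complex.normSq (diagMatrix alpha).det

lemma detScale_pos : 0 < detScale := Complex.normSq_pos.2 det_diagMatrix_alpha_ne_zero

lemma codeword_ne_zero {x : Fin 4 → 𝓞 L} (hx : x ≠ 0) : codeword x ≠ 0 := by
  intro h
  have hdet := det_codeword x
  rw [h, Matrix.det_zero, eq_comm, mul_eq_zero] at hdet
  refine hdet.elim det_diagMatrix_alpha_ne_zero fun h0 => nrd_ne_zero hx ?_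
  exact toComplex_injective (h0.trans (map_zero toComplex).symm)

lemma codeword_injective : Function.Injective codeword := by
  intro x y h
  by_contra hne
  exact codeword_ne_zero (sub_ne_zero.2 hne) (by rw [← codeword_sub, h, sub_self])

lemma re_det_mul_conjTranspose (x : Fin 4 → 𝓞 L) :
    (codeword x * (codeword x).conjTranspose).det.re =
      detScale * Complex.normSq (toComplex (nrd x)) := by
  rw [Matrix.det_mul, Matrix.det_conjTranspose, ← starRingEnd_apply, Complex.mul_conj,
    Complex.ofReal_re, det_codeword, map_mul, detScale]

/-- The determinants of the nonzero codewords with entries in an ideal. -/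
def idealDets (a : Ideal (𝓞 L)) : Set ℝ :=
  {d | ∃ z : Fin 4 → 𝓞 L, z ≠ 0 ∧ (∀ l, z l ∈ a) ∧
    d = detScale * Complex.normSq (toComplex (nrd z))}

/-- The minimum of `idealDets a` exists and is at least `detScale * N(a)`, with equality for
principal `a`. -/
lemma exists_isLeast_idealDets {a : Ideal (𝓞 L)} (ha : a ≠ ⊥) :
    ∃ n : ℕ, IsLeast (idealDets a) (detScale * n) ∧ Ideal.absNorm a ≤ n ∧
      ((∃ g, a = Ideal.span {g}) → n = Ideal.absNorm a) := by
  classical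
  have hval : ∀ z : Fin 4 → 𝓞 L, z ≠ 0 → (∀ l, z l ∈ a) →
      ∃ n : ℕ, Complex.normSq (toComplex (nrd z)) = n ∧ Ideal.absNorm a ≤ n :=
    fun z hz hza => exists_normSq_nrd hza (nrd_ne_zero hz)
  have hsingle : ∀ g : 𝓞 L, g ≠ 0 → (fun l => g * (Pi.single 0 1 : Fin 4 → 𝓞 L) l) ≠ 0 :=
    fun g hg h => hg (by simpa using congrFun h 0)
  -- All these determinants are natural multiples of `detScale`, so a minimum exists by
  -- well-ordering.
  let p : ℕ → Prop := fun n => detScale * n ∈ idealDets a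
  have hex : ∃ n, p n := by
    obtain ⟨g, hga, hg⟩ := Submodule.exists_mem_ne_zero_of_ne_bot ha
    obtain ⟨n, hn, -⟩ := hval _ (hsingle g hg) fun l => Ideal.mul_mem_right _ _ hga
    exact ⟨n, _, hsingle g hg, fun l => Ideal.mul_mem_right _ _ hga, by rw [hn]⟩
  have hle : ∀ n, p n → Ideal.absNorm a ≤ n := by
    rintro n ⟨z, hz, hza, h⟩
    obtain ⟨k, hk, hak⟩ := hval z hz hza
    rw [hk] at h
    have hnk : n = k := by exact_mod_cast mul_left_cancel₀ detScale_pos.ne' h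
    exact hnk ▸ hak
  refine ⟨Nat.find hex, ⟨Nat.find_spec hex, ?_⟩, hle _ (Nat.find_spec hex), ?_⟩
  · rintro d ⟨z, hz, hza, rfl⟩
    obtain ⟨k, hk, -⟩ := hval z hz hza
    rw [hk]
    have hk' : Nat.find hex ≤ k := Nat.find_le ⟨z, hz, hza, by rw [hk]⟩
    exact mul_le_mul_of_nonneg_left (by exact_mod_cast hk') detScale_pos.le
  · rintro ⟨g, rfl⟩
    have hg : g ≠ 0 := by simpa using ha
    refine le_antisymm (Nat.find_le ⟨_, hsingle g hg, fun l => ?_, ?_⟩)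
      (hle _ (Nat.find_spec hex))
    · exact Ideal.mul_mem_right _ _ (Ideal.mem_span_singleton_self g)
    · rw [normSq_nrd_mul_single]

/-! ### Lattice codes, known residues and rates -/

section Code

variable {N : ℕ} {q : Fin N → Ideal (𝓞 L)} {M : (∀ k, 𝓞 L ⧸ q k) → 𝓞 L}

lemma mem_prod_iff (hq : Pairwise fun j k => IsCoprime (q j) (q k)) (S : Finset (Fin N))
    (x : 𝓞 L) : x ∈ ∏ s ∈ S, q s ↔ ∀ s ∈ S, x ∈ q s := by
  rw [Ideal.prod_eq_iInf_of_pairwise_isCoprime fun j _ k _ h => hq h]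
  simp

/-- The lattice code of a subcode consists of the codewords with the known residues. -/
lemma mem_latticeCode_subcode (hq : Pairwise fun j k => IsCoprime (q j) (q k))
    (hM : IsCosetLeaderMap q M) (S : Finset (Fin N)) (v : ∀ k, Message q k)
    (X : Matrix (Fin 4) (Fin 4) ℂ) :
    X ∈ latticeCode q (subcode M S v) ↔
      ∃ x : Fin 4 → 𝓞 L, (∀ s ∈ S, ∀ l, Ideal.Quotient.mk (q s) (x l) = v s l) ∧
        X = codeword x := by
  constructor
  · rintro ⟨_, ⟨w, hw, rfl⟩, z, hz, rfl⟩
    refine ⟨(fun l => M fun k => w k l) + z, fun s hs l => ?_, (codeword_add _ _).symm⟩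
    have hzs : Ideal.Quotient.mk (q s) (z l) = 0 := Ideal.Quotient.eq_zero_iff_mem.2
      ((mem_prod_iff hq Finset.univ _).1 (hz l) s (Finset.mem_univ s))
    rw [Pi.add_apply, map_add, hzs, add_zero, hM, hw s hs]
  · rintro ⟨x, hx, rfl⟩
    let w : ∀ k, Message q k := fun k l => Ideal.Quotient.mk (q k) (x l)
    refine ⟨encode M w, ⟨w, fun s hs => funext fun l => hx s hs l, rfl⟩,
      x - fun l => M fun k => w k l, fun l => ?_, ?_⟩
    · refine (mem_prod_iff hq Finset.univ _).2 fun k _ => ?_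
      rw [← Ideal.Quotient.eq_zero_iff_mem, Pi.sub_apply, map_sub, hM, sub_self]
    · rw [encode, ← codeword_add, add_sub_cancel]

lemma pairDets_latticeCode_subcode (hq : Pairwise fun j k => IsCoprime (q j) (q k))
    (hM : IsCosetLeaderMap q M) (S : Finset (Fin N)) (v : ∀ k, Message q k) :
    pairDets (latticeCode q (subcode M S v)) = idealDets (∏ s ∈ S, q s) := by
  ext d
  constructor
  · rintro ⟨X, hX, X', hX', hne, rfl⟩
    obtain ⟨x, hx, rfl⟩ := (mem_latticeCode_subcode hq hM S v X).1 hX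
    obtain ⟨x', hx', rfl⟩ := (mem_latticeCode_subcode hq hM S v X').1 hX'
    refine ⟨x - x', fun h => hne (by rw [sub_eq_zero.1 h]), fun l => ?_, ?_⟩
    · refine (mem_prod_iff hq S _).2 fun s hs => ?_
      rw [← Ideal.Quotient.eq_zero_iff_mem, Pi.sub_apply, map_sub, hx s hs, hx' s hs, sub_self]
    · rw [codeword_sub, re_det_mul_conjTranspose]
  · rintro ⟨z, hz, hza, rfl⟩
    let x : Fin 4 → 𝓞 L := fun l => M fun k => v k l
    have hx : ∀ s ∈ S, ∀ l, Ideal.Quotient.mk (q s) (x l) = v s l := fun s _ l => hM _ s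
    have hxz : ∀ s ∈ S, ∀ l, Ideal.Quotient.mk (q s) ((x + z) l) = v s l := fun s hs l => by
      rw [Pi.add_apply, map_add, hx s hs,
        Ideal.Quotient.eq_zero_iff_mem.2 ((mem_prod_iff hq S _).1 (hza l) s hs), add_zero]
    refine ⟨_, (mem_latticeCode_subcode hq hM S v _).2 ⟨x + z, hxz, rfl⟩,
      _, (mem_latticeCode_subcode hq hM S v _).2 ⟨x, hx, rfl⟩, ?_, ?_⟩
    · exact fun h => hz (by simpa using codeword_injective h)
    · rw [codeword_sub, add_sub_cancel_left, re_det_mul_conjTranspose]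

/-- This makes the full code the case `S = ∅`, with empty ideal product `⊤`. -/
lemma codebook_eq_subcode (v : ∀ k, Message q k) : codebook M = subcode M ∅ v := by
  ext X
  simp [codebook, subcode]

/-- The `8` is `32 / 4`: 32 real symbols per codeword, four coordinates per message. -/
lemma sum_rate (hq : ∀ k, q k ≠ ⊥) (S : Finset (Fin N)) :
    ∑ s ∈ S, rate q s = Real.logb 2 (Ideal.absNorm (∏ s ∈ S, q s)) / 8 := by
  have hcard : ∀ k, (Nat.card (Message q k) : ℝ) = (Ideal.absNorm (q k) : ℝ) ^ 4 := fun k => by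
    rw [Nat.card_fun, Nat.card_fin]
    push_cast
    rfl
  rw [map_prod, Nat.cast_prod, Real.logb_prod, Finset.sum_div]
  · refine Finset.sum_congr rfl fun s _ => ?_
    rw [rate, hcard, Real.logb_pow]
    push_cast
    ring
  · intro s _
    exact_mod_cast fun h => hq s (Ideal.absNorm_eq_zero_iff.1 h)

end Code

lemma gain_of_eq {A : ℝ} (hA : 1 < A) :
    10 * Real.logb 10 A / (4 * (Real.logb 2 A / 8)) = 20 * Real.logb 10 2 := by
  have hlog : Real.log A ≠ 0 := (Real.log_pos hA).ne'
  have h2 : Real.log 2 ≠ 0 := (Real.log_pos (by norm_num)).ne'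
  have h10 : Real.log 10 ≠ 0 := (Real.log_pos (by norm_num)).ne'
  rw [Real.logb, Real.logb, Real.logb]
  field_simp
  norm_num

end

end LSTIC

/-- The constant "6 dB" is `20 log₁₀ 2 ≈ 6.02`. -/
theorem mainTheorem5 (N : ℕ) (q : Fin N → Ideal (NumberField.RingOfIntegers LSTIC.L))
    (hq_ne_bot : ∀ k, q k ≠ ⊥)
    (hq_coprime : Pairwise fun j k => IsCoprime (q j) (q k))
    (M : (∀ k, NumberField.RingOfIntegers LSTIC.L ⧸ q k) →
      NumberField.RingOfIntegers LSTIC.L)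
    (hM : LSTIC.IsCosetLeaderMap q M)
    (S : Finset (Fin N)) (hS : ∃ s ∈ S, q s ≠ ⊤)
    (v : ∀ k, LSTIC.Message q k) :
    IsLeast (LSTIC.pairDets (LSTIC.latticeCode q (LSTIC.codebook M)))
        (LSTIC.minDet q (LSTIC.codebook M)) ∧
      IsLeast (LSTIC.pairDets (LSTIC.latticeCode q (LSTIC.subcode M S v)))
        (LSTIC.minDet q (LSTIC.subcode M S v)) ∧
      20 * Real.logb 10 2 ≤ LSTIC.sideInfoGain M S v ∧
      ((∀ k, Submodule.IsPrincipal (q k)) →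
        LSTIC.sideInfoGain M S v = 20 * Real.logb 10 2) := by
  have ha : ∏ s ∈ S, q s ≠ ⊥ := Finset.prod_ne_zero_iff.2 fun s _ => hq_ne_bot s
  have hone : ∏ s ∈ (∅ : Finset (Fin N)), q s ≠ ⊥ :=
    Finset.prod_ne_zero_iff.2 fun s _ => hq_ne_bot s
  obtain ⟨n, hn, han, hprin⟩ := LSTIC.exists_isLeast_idealDets ha
  obtain ⟨n₀, hn₀, -, hprin₀⟩ := LSTIC.exists_isLeast_idealDets hone
  have h1 : n₀ = 1 := by
    rw [hprin₀ ⟨1, by simp⟩]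
    simp
  rw [← LSTIC.pairDets_latticeCode_subcode hq_coprime hM S v] at hn
  rw [← LSTIC.pairDets_latticeCode_subcode hq_coprime hM ∅ v, ← LSTIC.codebook_eq_subcode, h1,
    Nat.cast_one, mul_one] at hn₀
  have hmin : LSTIC.minDet q (LSTIC.subcode M S v) = LSTIC.detScale * n := hn.csInf_eq
  have hmin₀ : LSTIC.minDet q (LSTIC.codebook M) = LSTIC.detScale := hn₀.csInf_eq
  have hgain : LSTIC.sideInfoGain M S v = 10 * Real.logb 10 n /
      (4 * (Real.logb 2 (Ideal.absNorm (∏ s ∈ S, q s)) / 8)) := by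
    rw [LSTIC.sideInfoGain, hmin, hmin₀, mul_div_cancel_left₀ _ LSTIC.detScale_pos.ne',
      LSTIC.sum_rate hq_ne_bot]
  -- A proper `q s` makes the total rate positive, so the gain does not divide by zero.
  have hA : 1 < Ideal.absNorm (∏ s ∈ S, q s) := by
    obtain ⟨s, hs, htop⟩ := hS
    have hne0 : Ideal.absNorm (∏ s ∈ S, q s) ≠ 0 := fun h => ha (Ideal.absNorm_eq_zero_iff.1 h)
    have hne1 : Ideal.absNorm (∏ s ∈ S, q s) ≠ 1 := fun h => htop (top_le_iff.1
      (Ideal.absNorm_eq_one_iff.1 h ▸ Ideal.dvd_iff_le.1 (Finset.dvd_prod_of_mem q hs)))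
    omega
  have hA' : (1 : ℝ) < Ideal.absNorm (∏ s ∈ S, q s) := by exact_mod_cast hA
  rw [hmin, hmin₀, hgain]
  refine ⟨hn₀, hn, ?_, fun hp => ?_⟩
  · rw [← LSTIC.gain_of_eq hA']
    have hlog : 0 < Real.logb 2 (Ideal.absNorm (∏ s ∈ S, q s)) :=
      Real.logb_pos (by norm_num) hA'
    have hle : Real.logb 10 (Ideal.absNorm (∏ s ∈ S, q s)) ≤ Real.logb 10 n :=
      Real.logb_le_logb_of_le (by norm_num) (by linarith) (by exact_mod_cast han)
    gcongr
  · rw [hprin, LSTIC.gain_of_eq hA']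
    choose g hg using fun k => (hp k).principal
    refine ⟨∏ s ∈ S, g s, ?_⟩
    rw [← Ideal.prod_span_singleton]
    exact Finset.prod_congr rfl fun s _ => hg s
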